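/- Let $J_4$ be the cactus group on $4$ strands: the group with generators $s_{p,q}$ ($1\le p<q\le 4$) and relations $s_{p,q}^2=1$; $s_{p,q}s_{m,r}=s_{m,r}s_{p,q}$ if $[p,q]\cap[m,r]=\emptyset$; and $s_{p,q}s_{m,r}=s_{p+q-r,\,p+q-m}\,s_{p,q}$ if $[m,r]\subset[p,q]$. Let $PJ_4$ be the pure cactus group, that is, the kernel of the group morphism $J_4\to S_4$ sending each $s_{p,q}$ to the permutation that reverses the interval $[p,q]$ (it sends $i$ to $p+q-i$ for $p\le i\le q$) and fixes all other points. Then the elements \begin{align*} \alpha &= (s_{1,3} s_{1,2})^3,\\ \beta&= s_{1,2} s_{1,3} s_{1,4} s_{1,3} s_{1,4} s_{1,2} s_{1,4} = s_{1,3} s_{1,4} s_{1,3} (s_{1,2}s_{1,4})^2,\\ \gamma&= s_{1,2} s_{1,4} s_{1,2} (s_{1,3}s_{1,4})^2,\\ \delta&= s_{1,3} (s_{1,2} s_{1,4})^2 s_{1,3} s_{1,4} ,\\ \epsilon&= (s_{1,4} s_{1,2} s_{1,3} s_{1,2})^2 \end{align*} belong to $PJ_4$ (including the asserted equality of the two expressions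 for $\beta$ in $J_4$), and on these generators the group $PJ_4$ has the presentation \[PJ_4=\langle \alpha, \beta, \gamma, \delta, \epsilon \mid \alpha \gamma \epsilon \beta \epsilon \alpha^{-1} \delta^{-1} \beta \gamma \delta^{-1}=1\rangle .\] -/

import Mathlib

/-- The index `(p, q)`, with `1 ≤ p < q ≤ n`, of a generator `s_{p,q}` of the cactus group `J_n`. -/
@[ext]
structure CactusGen (n : ℕ) where
  p : ℕ
  q : ℕ
  one_le : 1 ≤ p
  lt : p < q
  le : q ≤ n

namespace CactusGen

/-- The integer interval `[p, q]`. -/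
def interval {n : ℕ} (a : CactusGen n) : Finset ℕ := Finset.Icc a.p a.q

/-- The reversal of the interval `[p, q]`, as a permutation of `{1, …, n}`: it exchanges
`i` and `p + q - i` for `p ≤ i ≤ q`, and fixes all other points. -/
def reversal {n : ℕ} (a : CactusGen n) : Equiv.Perm (Finset.Icc 1 n) :=
  Function.Involutive.toPerm
    (fun i => ⟨if a.p ≤ i.1 ∧ i.1 ≤ a.q then a.p + a.q - i.1 else i.1, by
      have h1 := a.one_le
      have h2 := a.le
      have h3 := Finset.mem_Icc.1 i.2
      rw [Finset.mem_Icc]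
      split_ifs <;> omega⟩)
    (by
      intro i
      apply Subtype.ext
      dsimp only
      split_ifs <;> omega)

theorem reversal_apply {n : ℕ} (a : CactusGen n) (i : Finset.Icc 1 n) :
    ((a.reversal i : Finset.Icc 1 n) : ℕ)
      = if a.p ≤ i.1 ∧ i.1 ≤ a.q then a.p + a.q - i.1 else i.1 := rfl

end CactusGen

/-- The defining relators of the cactus group `J_n`:
`s_{p,q}^2 = 1`;
`s_{p,q} s_{m,r} = s_{m,r} s_{p,q}` if `[p,q] ∩ [m,r] = ∅`;
`s_{p,q} s_{m,r} = s_{p+q-r,p+q-m} s_{p,q}` if `[m,r] ⊆ [p,q]`. -/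
inductive IsCactusRelator (n : ℕ) : FreeGroup (CactusGen n) → Prop
  | square (a : CactusGen n) : IsCactusRelator n (FreeGroup.of a ^ 2)
  | commutation (a b : CactusGen n) (h : Disjoint a.interval b.interval) :
      IsCactusRelator n
        (FreeGroup.of a * FreeGroup.of b * (FreeGroup.of b * FreeGroup.of a)⁻¹)
  | conjugation (a b c : CactusGen n) (h : b.interval ⊆ a.interval)
      (hp : c.p = a.p + a.q - b.q) (hq : c.q = a.p + a.q - b.p) :
      IsCactusRelator n
        (FreeGroup.of a * FreeGroup.of b * (FreeGroup.of c * FreeGroup.of a)⁻¹)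

/-- The cactus group `J_n`. -/
abbrev CactusGroup (n : ℕ) : Type := PresentedGroup {w | IsCactusRelator n w}

namespace CactusGroup

/-- The element `s_{p,q}` of `J_n`. -/
def s {n : ℕ} (p q : ℕ) (one_le : 1 ≤ p := by norm_num) (lt : p < q := by norm_num)
    (le : q ≤ n := by norm_num) : CactusGroup n :=
  PresentedGroup.of ⟨p, q, one_le, lt, le⟩

theorem reversal_relator {n : ℕ} (w : FreeGroup (CactusGen n)) (hw : IsCactusRelator n w) :
    FreeGroup.lift CactusGen.reversal w = 1 := by
  cases hw with
  | square a =>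
    rw [map_pow, FreeGroup.lift_apply_of]
    ext i
    simp only [pow_two, Equiv.Perm.mul_apply, Equiv.Perm.one_apply, CactusGen.reversal_apply]
    split_ifs <;> omega
  | commutation a b h =>
    have hab : a.q < b.p ∨ b.q < a.p := by
      by_contra hcon
      have ha := a.lt
      have hb := b.lt
      have h1 : max a.p b.p ∈ a.interval := by
        simp only [CactusGen.interval, Finset.mem_Icc]; omega
      have h2 : max a.p b.p ∈ b.interval := by
        simp only [CactusGen.interval, Finset.mem_Icc]; omega
      exact Finset.disjoint_left.1 h h1 h2
    simp only [map_mul, map_inv, FreeGroup.lift_apply_of]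
    rw [mul_inv_eq_one]
    ext i
    simp only [Equiv.Perm.mul_apply, CactusGen.reversal_apply]
    have ha := a.lt
    have hb := b.lt
    split_ifs <;> omega
  | conjugation a b c h hp hq =>
    have ha := a.lt
    have hb := b.lt
    have hab := (Finset.Icc_subset_Icc_iff hb.le).1 h
    simp only [map_mul, map_inv, FreeGroup.lift_apply_of]
    rw [mul_inv_eq_one]
    ext i
    simp only [Equiv.Perm.mul_apply, CactusGen.reversal_apply]
    split_ifs <;> omega

/-- The group morphism `J_n → S_n` that sends `s_{p,q}` to the reversal of `[p, q]`. -/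
def toPerm (n : ℕ) : CactusGroup n →* Equiv.Perm (Finset.Icc 1 n) :=
  PresentedGroup.toGroup (f := CactusGen.reversal) reversal_relator

end CactusGroup

/-- The pure cactus group `PJ_n`. -/
def PureCactusGroup (n : ℕ) : Subgroup (CactusGroup n) := (CactusGroup.toPerm n).ker

/-- Names for the five generators of the one-relator presentation. -/
inductive PJ4Gen : Type
  | α
  | β
  | γ
  | δ
  | ε

/-- The word `α γ ε β ε α⁻¹ δ⁻¹ β γ δ⁻¹`. -/
def pj4Relator : FreeGroup PJ4Gen :=
  FreeGroup.of .α * FreeGroup.of .γ * FreeGroup.of .ε * FreeGroup.of .β * FreeGroup.of .ε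
    * (FreeGroup.of .α)⁻¹ * (FreeGroup.of .δ)⁻¹ * FreeGroup.of .β * FreeGroup.of .γ
    * (FreeGroup.of .δ)⁻¹

/-- The elements of `J_4` that the five generators stand for. -/
def pj4Word : PJ4Gen → CactusGroup 4
  | .α => (.s 1 3 * .s 1 2) ^ 3
  | .β => .s 1 2 * .s 1 3 * .s 1 4 * .s 1 3 * .s 1 4 * .s 1 2 * .s 1 4
  | .γ => .s 1 2 * .s 1 4 * .s 1 2 * (.s 1 3 * .s 1 4) ^ 2
  | .δ => .s 1 3 * (.s 1 2 * .s 1 4) ^ 2 * .s 1 3 * .s 1 4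
  | .ε => (.s 1 4 * .s 1 2 * .s 1 3 * .s 1 2) ^ 2

/-!
The presentation of `PJ₄` is obtained by the Reidemeister–Schreier method, but no large
presentation is simplified: the one-relator presentation is checked through an induced action.

Write `a = s_{1,2}`, `b = s_{1,3}`, `c = s_{1,4}`. They generate `J₄`, and the relations reduce to
`a² = b² = c² = 1`, `(a c)⁴ = 1` and `b a b c = c b a b`
(`IsCactusTriple.exists_hom`, `CactusGroup.isCactusTriple`). Read as rewriting rules
(`IsCactusTriple.rewriting`), these relations prove the equalities of words in `J₄` that are needed,
such as the relation between the five given elements.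

Let `P` be the one-relator group and `φ : P → J₄` the morphism given by the five words. Its image
lies in `PJ₄`. The `24` cosets of `PJ₄` have representatives `t k` stable under left multiplication
by the dihedral group `⟨a, c⟩` of order `8`, and `b * t k = t (b • k) * φ (w k)` for explicit
`w k : P` (`PJ4.cocycle`). Hence `a`, `b`, `c` should act on `P × {cosets}` by
`a (p, k) = (p, a • k)`, `b (p, k) = (w k * p, b • k)`, `c (p, k) = (p, c • k)`. These permutations
do satisfy the relations of `J₄` (`PJ4.isCactusTriple_perm`), the relator of `P` being what
`b a b c = c b a b` requires on one orbit of cosets. In the resulting action of `J₄`: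

* `φ p` sends `(q, 0)` to `(p * q, 0)`, where `0` is the trivial coset (`PJ4.induced_toCactus`), so
  `φ` is injective;
* `(p, k) ↦ t k * φ p` is equivariant for left translation on `J₄`
  (`PJ4.transversal_mul_toCactus`). If `g ∈ PJ₄` sends `(1, 0)` to `(p, k)`, then `g = t k * φ p`,
  so `t k ∈ PJ₄`, `k = 0` and `g = φ p`: thus `φ` maps onto `PJ₄`.
-/

/-! ### Four-strand cactus group on three generators -/

/-- The relations satisfied by `a = s_{1,2}`, `b = s_{1,3}`, `c = s_{1,4}` in `J₄`, written without
inverses. They present `J₄`; see `IsCactusTriple.exists_hom`. -/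
structure IsCactusTriple {H : Type*} [Group H] (a b c : H) : Prop where
  aa : a * a = 1
  bb : b * b = 1
  cc : c * c = 1
  caca : c * (a * (c * a)) = a * (c * (a * c))
  babc : b * (a * (b * c)) = c * (b * (a * b))

namespace IsCactusTriple

variable {H : Type*} [Group H] {a b c : H}

theorem bcba (h : IsCactusTriple a b c) : b * (c * (b * a)) = a * (b * (c * b)) := by
  have ha (x : H) : a * (a * x) = x := by rw [← mul_assoc, h.aa, one_mul]
  have hb (x : H) : b * (b * x) = x := by rw [← mul_assoc, h.bb, one_mul]
  have := congrArg (fun x => a * (b * (x * (b * a)))) h.babc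
  simpa only [mul_assoc, ha, hb, h.aa, h.bb, mul_one] using this

/-- The relations of a cactus triple as rewriting rules for words in `a`, `b`, `c` associated to the
right: each left side is replaced by the right side, at the end of a word or followed by a further
factor. The rules terminate: each one shortens the word or
makes it lexicographically smaller for the order `a < c < b`. -/
theorem rewriting (h : IsCactusTriple a b c) :
    (a * a = 1 ∧ ∀ x, a * (a * x) = x) ∧
    (b * b = 1 ∧ ∀ x, b * (b * x) = x) ∧
    (c * c = 1 ∧ ∀ x, c * (c * x) = x) ∧
    (c * (a * (c * a)) = a * (c * (a * c)) ∧
      ∀ x, c * (a * (c * (a * x))) = a * (c * (a * (c * x)))) ∧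
    (b * (a * (b * c)) = c * (b * (a * b)) ∧
      ∀ x, b * (a * (b * (c * x))) = c * (b * (a * (b * x)))) ∧
    (b * (c * (b * a)) = a * (b * (c * b)) ∧
      ∀ x, b * (c * (b * (a * x))) = a * (b * (c * (b * x)))) := by
  have tail {u v : H} (e : u = v) (x : H) : u * x = v * x := by rw [e]
  refine ⟨⟨h.aa, ?_⟩, ⟨h.bb, ?_⟩, ⟨h.cc, ?_⟩, ⟨h.caca, ?_⟩, ⟨h.babc, ?_⟩, ⟨h.bcba, ?_⟩⟩
  · simpa only [mul_assoc, one_mul] using tail h.aa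
  · simpa only [mul_assoc, one_mul] using tail h.bb
  · simpa only [mul_assoc, one_mul] using tail h.cc
  · simpa only [mul_assoc] using tail h.caca
  · simpa only [mul_assoc] using tail h.babc
  · simpa only [mul_assoc] using tail h.bcba

/-- The universal property: a cactus triple is the image of `s_{1,2}`, `s_{1,3}`, `s_{1,4}` under a
morphism from `J₄`. The other generators `s_{2,3}`, `s_{2,4}`, `s_{3,4}` go to `b a b`, `c b c`,
`c a c`. -/
theorem exists_hom (h : IsCactusTriple a b c) :
    ∃ f : CactusGroup 4 →* H, f (.s 1 2) = a ∧ f (.s 1 3) = b ∧ f (.s 1 4) = c := by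
  obtain ⟨⟨aa, aa'⟩, ⟨bb, bb'⟩, ⟨cc, cc'⟩, ⟨caca, -⟩, ⟨babc, babc'⟩, ⟨-, bcba'⟩⟩ := h.rewriting
  let F : CactusGen 4 → H := fun g =>
    if g.p = 1 then (if g.q = 2 then a else if g.q = 3 then b else c)
    else if g.p = 2 then (if g.q = 3 then b * (a * b) else c * (b * c))
    else c * (a * c)
  have hF : ∀ w ∈ {w | IsCactusRelator 4 w}, FreeGroup.lift F w = 1 := by
    rintro w (⟨x⟩ | ⟨x, y, hxy⟩ | ⟨x, y, z, hyx, hp, hq⟩)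
    · obtain ⟨p, q, h1, h2, h3⟩ := x
      rw [map_pow, FreeGroup.lift_apply_of]
      have : p ≤ 3 := by omega
      interval_cases p <;> interval_cases q <;>
        simp [F, pow_two, mul_assoc, aa, bb, cc, aa', bb', cc']
    · obtain ⟨p, q, h1, h2, h3⟩ := x
      obtain ⟨p', q', h1', h2', h3'⟩ := y
      have hd : q < p' ∨ q' < p := by
        by_contra hcon
        have hx : max p p' ∈ Finset.Icc p q := Finset.mem_Icc.2 (by omega)
        have hy : max p p' ∈ Finset.Icc p' q' := Finset.mem_Icc.2 (by omega)
        exact Finset.disjoint_left.1 hxy hx hy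
      simp only [map_mul, map_inv, FreeGroup.lift_apply_of, mul_inv_eq_one]
      -- two disjoint intervals in `{1, 2, 3, 4}` are `[1, 2]` and `[3, 4]`
      have hpq : (p = 1 ∧ q = 2 ∧ p' = 3 ∧ q' = 4) ∨ (p = 3 ∧ q = 4 ∧ p' = 1 ∧ q' = 2) := by omega
      obtain ⟨rfl, rfl, rfl, rfl⟩ | ⟨rfl, rfl, rfl, rfl⟩ := hpq <;>
        simp [F, mul_assoc, caca]
    · obtain ⟨p, q, h1, h2, h3⟩ := x
      obtain ⟨p', q', h1', h2', h3'⟩ := y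
      obtain ⟨p'', q'', h1'', h2'', h3''⟩ := z
      obtain ⟨hpp, hqq⟩ : p ≤ p' ∧ q' ≤ q := (Finset.Icc_subset_Icc_iff h2'.le).1 hyx
      simp only at hp hq
      subst hp hq
      simp only [map_mul, map_inv, FreeGroup.lift_apply_of, mul_inv_eq_one]
      have : p ≤ 3 := by omega
      have : p' ≤ 3 := by omega
      interval_cases p <;> interval_cases q <;> interval_cases p' <;> interval_cases q' <;>
        simp [F, mul_assoc, aa, bb, cc, aa', bb', cc', babc, babc', bcba']
  exact ⟨PresentedGroup.toGroup hF, PresentedGroup.toGroup.of hF, PresentedGroup.toGroup.of hF,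
    PresentedGroup.toGroup.of hF⟩

end IsCactusTriple

namespace CactusGroup

theorem of_mul_self {n : ℕ} (x : CactusGen n) :
    (PresentedGroup.of x * PresentedGroup.of x : CactusGroup n) = 1 := by
  simpa only [pow_two] using! PresentedGroup.one_of_mem (rels := {w | IsCactusRelator n w})
    (IsCactusRelator.square x)

theorem of_inv {n : ℕ} (x : CactusGen n) :
    (PresentedGroup.of x : CactusGroup n)⁻¹ = PresentedGroup.of x :=
  inv_eq_of_mul_eq_one_left (of_mul_self x)

theorem of_mul_of_eq {n : ℕ} (x y z : CactusGen n) (h : y.interval ⊆ x.interval)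
    (hp : z.p = x.p + x.q - y.q) (hq : z.q = x.p + x.q - y.p) :
    (PresentedGroup.of x * PresentedGroup.of y : CactusGroup n) =
      PresentedGroup.of z * PresentedGroup.of x :=
  mul_inv_eq_one.1 (PresentedGroup.one_of_mem (rels := {w | IsCactusRelator n w})
    (IsCactusRelator.conjugation x y z h hp hq))

theorem s23_eq : (s 2 3 : CactusGroup 4) = s 1 3 * (s 1 2 * s 1 3) := by
  have h : (s 1 3 * s 1 2 : CactusGroup 4) = s 2 3 * s 1 3 :=
    of_mul_of_eq _ _ _ (by decide) rfl rfl
  rw [← mul_assoc, h, mul_assoc]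
  exact (mul_one _).symm.trans (congrArg _ (of_mul_self _).symm)

theorem s24_eq : (s 2 4 : CactusGroup 4) = s 1 4 * (s 1 3 * s 1 4) := by
  have h : (s 1 4 * s 1 3 : CactusGroup 4) = s 2 4 * s 1 4 :=
    of_mul_of_eq _ _ _ (by decide) rfl rfl
  rw [← mul_assoc, h, mul_assoc]
  exact (mul_one _).symm.trans (congrArg _ (of_mul_self _).symm)

theorem s34_eq : (s 3 4 : CactusGroup 4) = s 1 4 * (s 1 2 * s 1 4) := by
  have h : (s 1 4 * s 1 2 : CactusGroup 4) = s 3 4 * s 1 4 :=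
    of_mul_of_eq _ _ _ (by decide) rfl rfl
  rw [← mul_assoc, h, mul_assoc]
  exact (mul_one _).symm.trans (congrArg _ (of_mul_self _).symm)

/-- The relations `s_{1,4} s_{2,3} = s_{2,3} s_{1,4}` and `s_{1,2} s_{3,4} = s_{3,4} s_{1,2}` give
the last two conditions. -/
theorem isCactusTriple :
    IsCactusTriple (s 1 2 : CactusGroup 4) (s 1 3) (s 1 4) where
  aa := of_mul_self _
  bb := of_mul_self _
  cc := of_mul_self _
  caca := by
    have h : (s 3 4 * s 1 2 : CactusGroup 4) = s 1 2 * s 3 4 :=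
      mul_inv_eq_one.1 (PresentedGroup.one_of_mem (rels := {w | IsCactusRelator 4 w})
        (IsCactusRelator.commutation ⟨3, 4, by simp, by simp, by simp⟩
          ⟨1, 2, by simp, by simp, by simp⟩ (by decide)))
    simpa only [s34_eq, mul_assoc] using h
  babc := by
    have h : (s 1 4 * s 2 3 : CactusGroup 4) = s 2 3 * s 1 4 :=
      of_mul_of_eq _ _ _ (by decide) rfl rfl
    simpa only [s23_eq, mul_assoc] using h.symm

/-- `s_{1,2}`, `s_{1,3}` and `s_{1,4}` generate `J₄`, as an induction principle. -/
theorem four_induction {motive : CactusGroup 4 → Prop} (one : motive 1)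
    (mul : ∀ x y, motive x → motive y → motive (x * y)) (s12 : motive (s 1 2))
    (s13 : motive (s 1 3)) (s14 : motive (s 1 4)) (g : CactusGroup 4) : motive g := by
  have hof : ∀ x : CactusGen 4, motive (PresentedGroup.of x) := by
    rintro ⟨p, q, h1, h2, h3⟩
    have hp : p ≤ 3 := by omega
    interval_cases p <;> interval_cases q
    · exact s12
    · exact s13
    · exact s14
    · exact s23_eq.symm.subst (motive := motive) (mul _ _ s13 (mul _ _ s12 s13))
    · exact s24_eq.symm.subst (motive := motive) (mul _ _ s14 (mul _ _ s13 s14))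
    · exact s34_eq.symm.subst (motive := motive) (mul _ _ s14 (mul _ _ s12 s14))
  obtain ⟨w, rfl⟩ := PresentedGroup.mk_surjective _ g
  induction w using FreeGroup.induction_on with
  | C1 => exact one
  | of x => exact hof x
  | inv_of x _ => exact (of_inv x).symm.subst (motive := motive) (hof x)
  | mul x y hx hy => exact mul _ _ hx hy

end CactusGroup

/-! ### Coset table of the pure cactus group -/

namespace PJ4

/-- The group with generators `α, β, γ, δ, ε` and the single relator `pj4Relator`. -/
abbrev OneRelator : Type := PresentedGroup ({pj4Relator} : Set (FreeGroup PJ4Gen))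

/-- Words in `a = s_{1,2}`, `b = s_{1,3}`, `c = s_{1,4}` representing the left cosets of `PJ₄` in
`J₄`. The coset with index `8 * i + j` is represented by `d u`, where `d` is the `j`-th element of
the dihedral group `⟨a, c⟩` of order `8`, and `u` is `1`, `b` or `b a` according to `i`. -/
def cosetWord (k : Fin 24) : List (CactusGen 4) :=
  let a : CactusGen 4 := ⟨1, 2, by simp, by simp, by simp⟩
  let b : CactusGen 4 := ⟨1, 3, by simp, by simp, by simp⟩
  let c : CactusGen 4 := ⟨1, 4, by simp, by simp, by simp⟩
  ![[], [a], [c], [a, c], [c, a], [a, c, a], [c, a, c], [a, c, a, c],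
    [b], [a, b], [c, b], [a, c, b], [c, a, b], [a, c, a, b], [c, a, c, b], [a, c, a, c, b],
    [b, a], [a, b, a], [c, b, a], [a, c, b, a], [c, a, b, a], [a, c, a, b, a], [c, a, c, b, a],
    [a, c, a, c, b, a]] k

/-- The representatives of the left cosets of `PJ₄` in `J₄`. -/
def transversal (k : Fin 24) : CactusGroup 4 := ((cosetWord k).map PresentedGroup.of).prod

/-- The action of `s_{1,2}` on the cosets. -/
def act12 : Fin 24 → Fin 24 :=
  ![1, 0, 3, 2, 5, 4, 7, 6, 9, 8, 11, 10, 13, 12, 15, 14, 17, 16, 19, 18, 21, 20, 23, 22]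

/-- The action of `s_{1,3}` on the cosets. -/
def act13 : Fin 24 → Fin 24 :=
  ![8, 16, 15, 21, 23, 13, 18, 10, 0, 17, 7, 19, 22, 5, 20, 2, 1, 9, 6, 11, 14, 3, 12, 4]

/-- The action of `s_{1,4}` on the cosets. -/
def act14 : Fin 24 → Fin 24 :=
  ![2, 4, 0, 6, 1, 7, 3, 5, 10, 12, 8, 14, 9, 15, 11, 13, 18, 20, 16, 22, 17, 23, 19, 21]

/-- The Schreier cocycle of `s_{1,3}`: if `φ` is the map `OneRelator →* J₄`, then
`s_{1,3} * transversal k = transversal (act13 k) * φ (cocycle k)`. The cocycles of `s_{1,2}` and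
`s_{1,4}` are trivial, because the transversal is stable under left multiplication by the finite
group they generate. -/
def cocycle : Fin 24 → OneRelator :=
  let α : OneRelator := PresentedGroup.of .α
  let β : OneRelator := PresentedGroup.of .β
  let γ : OneRelator := PresentedGroup.of .γ
  let δ : OneRelator := PresentedGroup.of .δ
  let ε : OneRelator := PresentedGroup.of .ε
  ![1, 1, δ, ε⁻¹, ε⁻¹ * γ⁻¹, δ * γ⁻¹, β, β,
    1, α⁻¹, β⁻¹, β * ε * α⁻¹ * δ⁻¹, ε⁻¹ * γ⁻¹ * α⁻¹, γ * δ⁻¹, α⁻¹ * δ⁻¹, δ⁻¹,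
    1, α, β⁻¹, δ * α * ε⁻¹ * β⁻¹, δ * α, ε, α * γ * ε, γ * ε]

/-- The relation of `OneRelator`, solved for a factor `β ε α⁻¹ δ⁻¹ β`. -/
theorem relation :
    (.of .β * (.of .ε * ((.of .α)⁻¹ * ((.of .δ)⁻¹ * .of .β))) : OneRelator) =
      (.of .ε)⁻¹ * ((.of .γ)⁻¹ * ((.of .α)⁻¹ * (.of .δ * (.of .γ)⁻¹))) := by
  have h : (.of .α * .of .γ * .of .ε * .of .β * .of .ε * (.of .α)⁻¹ * (.of .δ)⁻¹ * .of .β *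
      .of .γ * (.of .δ)⁻¹ : OneRelator) = 1 :=
    PresentedGroup.one_of_mem (rels := {pj4Relator}) rfl
  have h' := congrArg (fun x : OneRelator =>
    (.of .ε)⁻¹ * ((.of .γ)⁻¹ * ((.of .α)⁻¹ * (x * (.of .δ * (.of .γ)⁻¹))))) h
  simpa [mul_assoc] using h'

/-- The cocycle is compatible with the relation `b a b c = c b a b` of `J₄`. On all but one of the
orbits of `⟨b a b, c⟩` this holds already in the free group; the remaining orbit, of cosets
`5`, `7`, `19`, `22`, is where the defining relation of `OneRelator` comes from. -/
theorem cocycle_babc (k : Fin 24) :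
    cocycle (act12 (act13 (act14 k))) * cocycle (act14 k) =
      cocycle (act12 (act13 k)) * cocycle k := by
  have h := relation
  have h' := congrArg (·⁻¹) h
  simp only [mul_inv_rev, inv_inv, mul_assoc] at h'
  fin_cases k <;> simp [act12, act13, act14, cocycle, mul_assoc]
  exacts [h, h.symm, h'.symm, h']

/-- The cocycle is compatible with the relation `b² = 1` of `J₄`. -/
theorem cocycle_act13_mul (k : Fin 24) : cocycle (act13 k) * cocycle k = 1 := by
  fin_cases k <;> simp [act13, cocycle, mul_assoc]

/-- The action of `s_{1,2}` induced from the left translation action of `OneRelator`. -/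
def perm12 : Equiv.Perm (OneRelator × Fin 24) :=
  Function.Involutive.toPerm (fun z => (z.1, act12 z.2)) fun z =>
    Prod.ext rfl ((by decide : ∀ k, act12 (act12 k) = k) z.2)

/-- The action of `s_{1,3}` induced from the left translation action of `OneRelator`. -/
def perm13 : Equiv.Perm (OneRelator × Fin 24) :=
  Function.Involutive.toPerm (fun z => (cocycle z.2 * z.1, act13 z.2)) fun z =>
    Prod.ext (by simp [← mul_assoc, cocycle_act13_mul])
      ((by decide : ∀ k, act13 (act13 k) = k) z.2)

/-- The action of `s_{1,4}` induced from the left translation action of `OneRelator`. -/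
def perm14 : Equiv.Perm (OneRelator × Fin 24) :=
  Function.Involutive.toPerm (fun z => (z.1, act14 z.2)) fun z =>
    Prod.ext rfl ((by decide : ∀ k, act14 (act14 k) = k) z.2)

theorem perm12_apply (z : OneRelator × Fin 24) : perm12 z = (z.1, act12 z.2) := rfl

theorem perm13_apply (z : OneRelator × Fin 24) : perm13 z = (cocycle z.2 * z.1, act13 z.2) := rfl

theorem perm14_apply (z : OneRelator × Fin 24) : perm14 z = (z.1, act14 z.2) := rfl

theorem isCactusTriple_perm : IsCactusTriple perm12 perm13 perm14 where
  aa := Equiv.ext perm12.symm_apply_apply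
  bb := Equiv.ext perm13.symm_apply_apply
  cc := Equiv.ext perm14.symm_apply_apply
  caca := by
    ext1 z
    have h : ∀ k, act14 (act12 (act14 (act12 k))) = act12 (act14 (act12 (act14 k))) := by decide
    simp only [Equiv.Perm.mul_apply, perm12_apply, perm14_apply, h]
  babc := by
    ext1 z
    have h : ∀ k, act13 (act12 (act13 (act14 k))) = act14 (act13 (act12 (act13 k))) := by decide
    simp only [Equiv.Perm.mul_apply, perm12_apply, perm13_apply, perm14_apply, ← mul_assoc,
      cocycle_babc, h]

/-! ### The one-relator group as the pure cactus group -/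

theorem lift_pj4Word_relator : FreeGroup.lift pj4Word pj4Relator = 1 := by
  obtain ⟨⟨aa, aa'⟩, ⟨bb, bb'⟩, ⟨cc, cc'⟩, ⟨caca, caca'⟩, ⟨-, babc'⟩,
    ⟨-, bcba'⟩⟩ := CactusGroup.isCactusTriple.rewriting
  have ai := inv_eq_of_mul_eq_one_left aa
  have bi := inv_eq_of_mul_eq_one_left bb
  have ci := inv_eq_of_mul_eq_one_left cc
  simp only [pj4Relator, pj4Word, map_mul, map_inv, FreeGroup.lift_apply_of, pow_succ, pow_zero,
    one_mul, mul_inv_rev, mul_assoc, ai, bi, ci, bb, aa', bb', cc', caca, caca',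
    babc', bcba']

/-- The morphism to `J₄` sending each generator of `OneRelator` to its value under `pj4Word`. -/
def toCactus : OneRelator →* CactusGroup 4 :=
  PresentedGroup.toGroup (f := pj4Word) fun _ hw => hw ▸ lift_pj4Word_relator

theorem toCactus_of (x : PJ4Gen) : toCactus (PresentedGroup.of x) = pj4Word x :=
  PresentedGroup.toGroup.of _

theorem pj4Word_mem (x : PJ4Gen) : pj4Word x ∈ PureCactusGroup 4 := by
  rw [PureCactusGroup, MonoidHom.mem_ker]
  cases x <;> simp only [pj4Word, map_mul, map_pow, CactusGroup.s, CactusGroup.toPerm,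
    PresentedGroup.toGroup.of] <;> decide

theorem toCactus_mem (p : OneRelator) : toCactus p ∈ PureCactusGroup 4 := by
  suffices (CactusGroup.toPerm 4).comp toCactus = 1 from DFunLike.congr_fun this p
  exact PresentedGroup.ext fun x => by
    simpa only [MonoidHom.comp_apply, toCactus_of] using! pj4Word_mem x

theorem s13_mul_transversal (k : Fin 24) :
    CactusGroup.s 1 3 * transversal k = transversal (act13 k) * toCactus (cocycle k) := by
  obtain ⟨⟨aa, aa'⟩, ⟨bb, bb'⟩, ⟨cc, cc'⟩, ⟨caca, caca'⟩, ⟨-, babc'⟩,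
    ⟨bcba, bcba'⟩⟩ := CactusGroup.isCactusTriple.rewriting
  have ai := inv_eq_of_mul_eq_one_left aa
  have bi := inv_eq_of_mul_eq_one_left bb
  have ci := inv_eq_of_mul_eq_one_left cc
  simp only [CactusGroup.s] at *
  fin_cases k <;> simp [act13, cocycle, toCactus_of, pj4Word, transversal, cosetWord,
    CactusGroup.s, pow_succ, mul_assoc, ai, bi, ci, bb, aa', bb', cc', caca, caca', babc',
    bcba, bcba']

theorem s12_mul_transversal (k : Fin 24) :
    CactusGroup.s 1 2 * transversal k = transversal (act12 k) := by
  obtain ⟨⟨aa, aa'⟩, -⟩ := CactusGroup.isCactusTriple.rewriting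
  simp only [CactusGroup.s] at *
  fin_cases k <;> simp [act12, transversal, cosetWord, aa, aa']

theorem s14_mul_transversal (k : Fin 24) :
    CactusGroup.s 1 4 * transversal k = transversal (act14 k) := by
  obtain ⟨-, -, ⟨cc, cc'⟩, ⟨caca, caca'⟩, -⟩ := CactusGroup.isCactusTriple.rewriting
  simp only [CactusGroup.s] at *
  fin_cases k <;> simp [act14, transversal, cosetWord, cc, cc', caca, caca']

theorem transversal_mem_iff (k : Fin 24) : transversal k ∈ PureCactusGroup 4 ↔ k = 0 := by
  have h : CactusGroup.toPerm 4 (transversal k) = ((cosetWord k).map CactusGen.reversal).prod := by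
    rw [transversal, map_list_prod, List.map_map]
    exact congrArg _ (List.map_congr_left fun x _ => PresentedGroup.toGroup.of _)
  rw [PureCactusGroup, MonoidHom.mem_ker, h]
  revert k
  decide

theorem transversal_zero : transversal 0 = 1 := rfl

variable {Φ : CactusGroup 4 →* Equiv.Perm (OneRelator × Fin 24)}

/-- In the induced action `Φ`, the elements of `PJ₄` coming from `OneRelator` stabilize the fibre
over the trivial coset and act on it by left translation. -/
theorem induced_toCactus (h12 : Φ (.s 1 2) = perm12) (h13 : Φ (.s 1 3) = perm13)
    (h14 : Φ (.s 1 4) = perm14) (p q : OneRelator) : Φ (toCactus p) (q, 0) = (p * q, 0) := by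
  have hof (x : PJ4Gen) (q : OneRelator) :
      Φ (toCactus (PresentedGroup.of x)) (q, 0) = (PresentedGroup.of x * q, 0) := by
    rw [toCactus_of]
    cases x <;> simp [pj4Word, pow_succ, h12, h13, h14, perm12_apply, perm13_apply, perm14_apply,
      act12, act13, act14, cocycle, mul_assoc]
  obtain ⟨w, rfl⟩ := PresentedGroup.mk_surjective _ p
  induction w using FreeGroup.induction_on generalizing q with
  | C1 => simp
  | of x => exact hof x q
  | inv_of x _ =>
    rw [map_inv, map_inv, map_inv, Equiv.Perm.inv_eq_iff_eq]
    exact ((hof x _).trans (Prod.ext (mul_inv_cancel_left _ _) rfl)).symm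
  | mul x y hx hy => rw [map_mul, map_mul, map_mul, Equiv.Perm.mul_apply, hy, hx, mul_assoc]

/-- The map `(p, k) ↦ transversal k * toCactus p` intertwines the induced action `Φ` with left
translation on `J₄`. -/
theorem transversal_mul_toCactus (h12 : Φ (.s 1 2) = perm12) (h13 : Φ (.s 1 3) = perm13)
    (h14 : Φ (.s 1 4) = perm14) (g : CactusGroup 4) (z : OneRelator × Fin 24) :
    transversal (Φ g z).2 * toCactus (Φ g z).1 = g * (transversal z.2 * toCactus z.1) := by
  induction g using CactusGroup.four_induction generalizing z with
  | one => simp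
  | mul x y hx hy => rw [map_mul, Equiv.Perm.mul_apply, hx, hy, mul_assoc]
  | s12 => rw [h12, perm12_apply, ← mul_assoc, s12_mul_transversal]
  | s13 => rw [h13, perm13_apply, ← mul_assoc, s13_mul_transversal, map_mul, mul_assoc]
  | s14 => rw [h14, perm14_apply, ← mul_assoc, s14_mul_transversal]

theorem toCactus_injective : Function.Injective toCactus := by
  obtain ⟨Φ, h12, h13, h14⟩ := isCactusTriple_perm.exists_hom
  intro p q hpq
  have h := induced_toCactus h12 h13 h14 p 1
  rw [hpq, induced_toCactus h12 h13 h14] at h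
  simpa using (congrArg Prod.fst h).symm

theorem exists_toCactus_eq {g : CactusGroup 4} (hg : g ∈ PureCactusGroup 4) :
    ∃ p, toCactus p = g := by
  obtain ⟨Φ, h12, h13, h14⟩ := isCactusTriple_perm.exists_hom
  have h := transversal_mul_toCactus h12 h13 h14 g (1, 0)
  rw [map_one, mul_one, transversal_zero, mul_one] at h
  have hk : transversal (Φ g (1, 0)).2 ∈ PureCactusGroup 4 :=
    (Subgroup.mul_mem_cancel_right _ (toCactus_mem _)).1 (h ▸ hg)
  rw [(transversal_mem_iff _).1 hk, transversal_zero, one_mul] at h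
  exact ⟨_, h⟩

end PJ4

theorem mainTheorem8 :
    (∃ e : PresentedGroup ({pj4Relator} : Set (FreeGroup PJ4Gen)) ≃* PureCactusGroup 4,
      ∀ x : PJ4Gen, (e (PresentedGroup.of x) : CactusGroup 4) = pj4Word x) ∧
    pj4Word .β =
      CactusGroup.s 1 3 * CactusGroup.s 1 4 * CactusGroup.s 1 3
        * (CactusGroup.s 1 2 * CactusGroup.s 1 4) ^ 2 := by
  refine ⟨⟨MulEquiv.ofBijective (PJ4.toCactus.codRestrict _ PJ4.toCactus_mem)
    ⟨(MonoidHom.injective_codRestrict _ _ _).2 PJ4.toCactus_injective, fun g => ?_⟩,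
    PJ4.toCactus_of⟩, ?_⟩
  · obtain ⟨p, hp⟩ := PJ4.exists_toCactus_eq g.2
    exact ⟨p, Subtype.ext hp⟩
  · obtain ⟨-, -, -, -, -, ⟨-, bcba'⟩⟩ := CactusGroup.isCactusTriple.rewriting
    simp only [pj4Word, pow_two, mul_assoc, bcba']
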